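/- Let $H$ be a complex Hilbert space with scalar product $\langle\cdot,\cdot\rangle$ linear in the first argument, and let $\{x_n\}_{n\in\mathbb Z}\subset H$ be stationary, i.e. $\langle x_{n+m},x_n\rangle$ does not depend on $n$. Let $\mu$ be its spectral measure, i.e. the finite positive measure on the unit circle $\mathbb T$ with $$\langle x_{n+m},x_n\rangle=\frac1{2\pi}\int_{\mathbb T}t^{-m}\,d\mu(t)\qquad(n,m\in\mathbb Z).$$ Assume that $\mu$ is absolutely continuous, $d\mu=f\,dt$, where $dt$ is arc length (of total mass $2\pi$) and $0\le f\in L_1(\mathbb T)$, and that $f$ satisfies the Paley–Wiener condition $\int_{\mathbb T}\log f(t)\,dt>-\infty$. Let $f_+$ be an outer function of the Hardy space $\mathbb H_2$ of the unit disc with $f=|f_+|^2$ almost everywhere on $\mathbb T$. Here $\mathbb H_2$ consists of the analytic functions $F$ on $\{|z|<1\}$ with $\sup_{r<1}\int_0^{2\pi}|F(re^{i\theta})|^2\,d\theta<\infty$; such a function is identified with its radial boundary values $F(e^{i\theta})=\lim_{r\to1-}F(re^{i\theta})$ (which exist a.e.), and a function $F\in\mathbb H_2$, $F\not\equiv 0$,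 is outer if $|F(0)|=\exp\bigl(\frac1{2\pi}\int_0^{2\pi}\log|F(e^{i\theta})|\,d\theta\bigr)$. For $L\ge1$ let $e_x^{\{L\}}=\|x_L-\mathrm{Pr}(x_L\mid H_0)\|$ be the $L$-lag prediction error, where $\mathrm{Pr}(\cdot\mid H_0)$ is the orthogonal projection onto the closed linear span $H_0$ of $x_0,x_{-1},x_{-2},\dots$. Then for every integer $L\ge1$, $$\bigl(e_x^{\{L\}}\bigr)^2=\sum_{n=0}^{L-1}\bigl|c_n\{f_+\}\bigr|^2,\qquad c_n\{f_+\}=\frac1{2\pi}\int_0^{2\pi}f_+(e^{i\theta})e^{-in\theta}\,d\theta,$$ and equivalently $$\inf_{N,\alpha_0,\dots,\alpha_N}\Bigl\|x_L-\sum_{n=0}^N\alpha_nx_{-n}\Bigr\|=\Bigl(\sum_{n=0}^{L-1}\bigl|c_n\{f_+\}\bigr|^2\Bigr)^{1/2},$$ where the infimum is over all $N\ge0$ and all $\alpha_0,\dots,\alpha_N\in\mathbb C$. -/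

import Mathlib

open MeasureTheory Filter Topology
open scoped ENNReal

namespace StationaryPrediction

instance factTwoPiPos : Fact (0 < 2 * Real.pi) := ⟨Real.two_pi_pos⟩

/-- The unit circle, parametrized by the angle `θ` modulo `2π`. The point of the complex unit
circle with angle `θ` is `fourier 1 θ = exp (i θ)`, and `fourier n θ = exp (i n θ)`. The measure
`volume` is arc length `dθ`, of total mass `2π`; `fourierCoeff g n` is
`(1 / 2π) ∫ g(θ) exp (-i n θ) dθ`. -/
abbrev UnitCircle : Type := AddCircle (2 * Real.pi)

section Sequences

variable {H : Type*} [NormedAddCommGroup H] [InnerProductSpace ℂ H]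

/-- A sequence in a Hilbert space is stationary if `⟨x (n + m), x n⟩` does not depend on `n`.
(Mathlib's inner product is linear in its second argument, so that the scalar product `⟨u, v⟩`,
linear in `u`, is `inner ℂ v u`.) -/
def IsStationary (x : ℤ → H) : Prop :=
  ∃ c : ℤ → ℂ, ∀ n m : ℤ, inner ℂ (x n) (x (n + m)) = c m

/-- `μ` is the spectral measure of the sequence `x`: a finite positive measure on the circle with
`⟨x (n + m), x n⟩ = (1 / 2π) ∫ t ^ (-m) dμ(t)` for all integers `n`, `m`. -/
def IsSpectralMeasure (x : ℤ → H) (μ : Measure UnitCircle) : Prop :=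
  IsFiniteMeasure μ ∧
    ∀ n m : ℤ, inner ℂ (x n) (x (n + m)) = (1 / (2 * Real.pi) : ℂ) * ∫ θ, fourier (-m) θ ∂μ

/-- The past up to time `n`: the closed linear span of `x n, x (n - 1), x (n - 2), …`. -/
def past (x : ℤ → H) (n : ℤ) : Submodule ℂ H :=
  (Submodule.span ℂ {y | ∃ k : ℤ, k ≤ n ∧ y = x k}).topologicalClosure

instance past_completeSpace [CompleteSpace H] (x : ℤ → H) (n : ℤ) : CompleteSpace (past x n) :=
  inferInstanceAs (CompleteSpace
    (Submodule.span ℂ {y | ∃ k : ℤ, k ≤ n ∧ y = x k}).topologicalClosure)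

/-- The `L`-lag prediction error `‖x L - Pr (x L | H₀)‖`, where `Pr (· | H₀)` is the orthogonal
projection onto the past `H₀` up to time `0`. -/
noncomputable def predictionError [CompleteSpace H] (x : ℤ → H) (L : ℕ) : ℝ :=
  ‖x L - (past x 0).starProjection (x L)‖

/-- The set of all numbers `‖x L - ∑_{n=0}^{N} α_n x (-n)‖`, over all `N` and all complex
coefficients `α_0, …, α_N`. -/
def finitePredictionErrors (x : ℤ → H) (L : ℕ) : Set ℝ :=
  {e | ∃ (N : ℕ) (α : ℕ → ℂ),
    e = ‖x L - ∑ n ∈ Finset.range (N + 1), α n • x (-(n : ℤ))‖}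

end Sequences

/-- The Paley–Wiener condition `∫ log f > -∞` for a non-negative integrable function `f`: the
negative part of the extended-real-valued function `log f` (with `log 0 = -∞`) has a finite
integral. -/
def PaleyWiener (f : UnitCircle → ℝ) : Prop :=
  ∫⁻ θ, (-ENNReal.log (ENNReal.ofReal (f θ))).toENNReal < ∞

/-- The Hardy space `H₂` of the open unit disc: analytic functions whose quadratic means over the
circles of radius `r < 1` are bounded. (Values of `F` outside the open disc are irrelevant.) -/
def IsHardyTwo (F : ℂ → ℂ) : Prop :=
  DifferentiableOn ℂ F (Metric.ball 0 1) ∧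
    ∃ C : ℝ, ∀ r : ℝ, 0 ≤ r → r < 1 → ∫ θ : UnitCircle, ‖F (r * fourier 1 θ)‖ ^ 2 ≤ C

/-- `g` is the boundary values function of `F`, i.e. its radial limit almost everywhere. -/
def IsBoundaryFunction (F : ℂ → ℂ) (g : UnitCircle → ℂ) : Prop :=
  ∀ᵐ θ : UnitCircle, Tendsto (fun r : ℝ => F (r * fourier 1 θ)) (𝓝[<] 1) (𝓝 (g θ))

/-- `F` is an outer function of class `H₂`, with boundary values function `g`:
`|F 0| = exp ((1 / 2π) ∫ log |g|)`. For every `F` in `H₂` other than the zero function, `g` is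
almost everywhere nonzero and `log |g|` is integrable; the zero function does not satisfy the
equation, since `Real.log 0 = 0`. -/
def IsOuterTwo (F : ℂ → ℂ) (g : UnitCircle → ℂ) : Prop :=
  IsHardyTwo F ∧ IsBoundaryFunction F g ∧
    ‖F 0‖ = Real.exp (1 / (2 * Real.pi) * ∫ θ : UnitCircle, Real.log ‖g θ‖)

end StationaryPrediction

namespace StationaryPrediction

/-! ### Prediction errors and the Gram matrix -/

section Hilbert

variable {H H' : Type*} [NormedAddCommGroup H] [InnerProductSpace ℂ H]
  [NormedAddCommGroup H'] [InnerProductSpace ℂ H']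

/-! The errors of finite predictors depend only on the Gram matrix, so the sequence may be replaced
by the model `rotations G`, that is e^{-ikθ}G in L² of the circle, where G is the boundary function
of the outer factor. There the past is the closed span of e^{inθ}G, n ≥ 0. Once it is known to be
the whole Hardy space, prediction of e^{-iLθ}G discards exactly its Fourier coefficients of negative
index, which are the first L coefficients of G (`predictionError_rotations_sq`).

The substance is cyclicity of G (`one_mem_past_rotations`). Let I be the part of G orthogonal to
e^{inθ}G, n ≥ 1. Its mean is c = F(0), so ‖I‖ ≥ |c|. Szegő's inequality (`norm_innovation_le_exp`)
gives ‖I‖ ≤ exp of the mean of log|G|, which equals |c| since F is outer. Hence I is the constant c,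
and the past contains the constants. Szegő's inequality comes from testing with e^{a(0)-a}G for a in
the disc algebra: the bound involves only Re a, hence extends by density to continuous and then
bounded functions, and finally to truncations of log|G|. No conjugate function is needed. -/

theorem sum_smul_mem_span_past (x : ℤ → H) (N : ℕ) (α : ℕ → ℂ) :
    ∑ n ∈ Finset.range (N + 1), α n • x (-(n : ℤ)) ∈
      Submodule.span ℂ {y | ∃ k : ℤ, k ≤ 0 ∧ y = x k} :=
  Submodule.sum_mem _ fun n _ => Submodule.smul_mem _ _ <|
    Submodule.subset_span ⟨-(n : ℤ), by simp, rfl⟩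

theorem exists_sum_of_mem_span_past (x : ℤ → H) {y : H}
    (hy : y ∈ Submodule.span ℂ {y | ∃ k : ℤ, k ≤ 0 ∧ y = x k}) :
    ∃ (N : ℕ) (α : ℕ → ℂ), y = ∑ n ∈ Finset.range (N + 1), α n • x (-(n : ℤ)) := by
  have hset : {y | ∃ k : ℤ, k ≤ 0 ∧ y = x k} = Set.range fun n : ℕ => x (-(n : ℤ)) := by
    ext z
    constructor
    · rintro ⟨k, hk, rfl⟩
      exact ⟨k.natAbs, by simp only; congr 1; omega⟩
    · rintro ⟨n, rfl⟩
      exact ⟨-(n : ℤ), by simp, rfl⟩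
  rw [hset, Finsupp.mem_span_range_iff_exists_finsupp] at hy
  obtain ⟨c, rfl⟩ := hy
  refine ⟨c.support.sup id, c, ?_⟩
  refine Finset.sum_subset (fun n hn => ?_) fun n _ hn => ?_
  · exact Finset.mem_range.2 (Nat.lt_succ_of_le (Finset.le_sup (f := id) hn))
  · simp only [Finsupp.notMem_support_iff.1 hn, zero_smul]

/-- The prediction error is the infimum of the errors of the finite linear predictors. -/
theorem isGLB_finitePredictionErrors [CompleteSpace H] (x : ℤ → H) (L : ℕ) :
    IsGLB (finitePredictionErrors x L) (predictionError x L) := by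
  constructor
  · rintro e ⟨N, α, rfl⟩
    rw [predictionError, Submodule.starProjection_minimal]
    exact ciInf_le ⟨0, by rintro _ ⟨w, rfl⟩; exact norm_nonneg _⟩
      (⟨_, Submodule.le_topologicalClosure _ (sum_smul_mem_span_past x N α)⟩ : past x 0)
  · intro b hb
    have hcl : ∀ z ∈ past x 0, b ≤ ‖x L - z‖ := by
      intro z hz
      refine closure_minimal (t := {z | b ≤ ‖x L - z‖}) (fun y hy => ?_)
        (isClosed_le continuous_const (by fun_prop)) hz
      obtain ⟨N, α, rfl⟩ := exists_sum_of_mem_span_past x hy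
      exact hb ⟨N, α, rfl⟩
    exact hcl _ (Submodule.starProjection_apply_mem _ _)

theorem norm_sub_sum_eq_of_gram {x : ℤ → H} {y : ℤ → H'}
    (h : ∀ n m, inner ℂ (x n) (x m) = inner ℂ (y n) (y m)) (L : ℤ) (s : Finset ℕ) (α : ℕ → ℂ) :
    ‖x L - ∑ n ∈ s, α n • x (-(n : ℤ))‖ = ‖y L - ∑ n ∈ s, α n • y (-(n : ℤ))‖ := by
  rw [@norm_eq_sqrt_re_inner ℂ, @norm_eq_sqrt_re_inner ℂ]
  simp only [inner_sub_left, inner_sub_right, inner_sum, sum_inner, inner_smul_left,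
    inner_smul_right, h]

/-- Sequences with the same Gram matrix have the same prediction errors. -/
theorem finitePredictionErrors_eq_of_gram {x : ℤ → H} {y : ℤ → H'}
    (h : ∀ n m, inner ℂ (x n) (x m) = inner ℂ (y n) (y m)) (L : ℕ) :
    finitePredictionErrors x L = finitePredictionErrors y L := by
  simp only [finitePredictionErrors, norm_sub_sum_eq_of_gram h]

end Hilbert

/-! ### Multiplication operators and the Hardy space on the circle -/

open AddCircle

/-- The space `L²` of the circle, for the normalized arc length. -/
abbrev L2Circle : Type := Lp ℂ 2 (haarAddCircle : Measure UnitCircle)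

/-- Multiplication of square-integrable functions by continuous functions. -/
noncomputable def mulL : C(UnitCircle, ℂ) →L[ℂ] L2Circle →L[ℂ] L2Circle :=
  ((ContinuousLinearMap.mul ℂ ℂ).holderL haarAddCircle ⊤ 2 2).comp
    (ContinuousMap.toLp ⊤ haarAddCircle ℂ)

theorem coeFn_mulL (q : C(UnitCircle, ℂ)) (g : L2Circle) :
    mulL q g =ᵐ[haarAddCircle] fun θ => q θ * g θ := by
  filter_upwards [(ContinuousLinearMap.mul ℂ ℂ).coeFn_holder (r := 2)
    (ContinuousMap.toLp ⊤ haarAddCircle ℂ q) g,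
    ContinuousMap.coeFn_toLp (p := ⊤) (𝕜 := ℂ) (haarAddCircle : Measure UnitCircle) q] with θ h1 h2
  rw [← h2]
  exact h1

theorem mulL_mul (p q : C(UnitCircle, ℂ)) (g : L2Circle) :
    mulL (p * q) g = mulL p (mulL q g) := by
  refine Lp.ext ?_
  filter_upwards [coeFn_mulL (p * q) g, coeFn_mulL p (mulL q g), coeFn_mulL q g] with θ h1 h2 h3
  rw [h1, h2, h3, ContinuousMap.mul_apply, mul_assoc]

theorem mulL_one (g : L2Circle) : mulL 1 g = g := by
  refine Lp.ext ?_
  filter_upwards [coeFn_mulL 1 g] with θ h1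
  rw [h1, ContinuousMap.one_apply, one_mul]

theorem fourier_mul_fourier (m n : ℤ) :
    (fourier m * fourier n : C(UnitCircle, ℂ)) = fourier (m + n) := by
  ext θ
  rw [ContinuousMap.mul_apply, fourier_add]

theorem fourier_zero_eq_one : (fourier 0 : C(UnitCircle, ℂ)) = 1 := by
  ext θ
  rw [fourier_zero, ContinuousMap.one_apply]

theorem mulL_fourier_fourierLp (m n : ℤ) :
    mulL (fourier m) (fourierLp 2 n) = fourierLp 2 (m + n) := by
  refine Lp.ext ?_
  filter_upwards [coeFn_mulL (fourier m) (fourierLp 2 n), coeFn_fourierLp (T := 2 * Real.pi) 2 n,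
    coeFn_fourierLp (T := 2 * Real.pi) 2 (m + n)] with θ h1 h2 h3
  rw [h1, h2, h3, fourier_add]

theorem inner_mulL_fourier (n m : ℤ) (g h : L2Circle) :
    inner ℂ (mulL (fourier n) g) (mulL (fourier m) h) = inner ℂ g (mulL (fourier (m - n)) h) := by
  rw [L2.inner_def, L2.inner_def]
  refine integral_congr_ae ?_
  filter_upwards [coeFn_mulL (fourier n) g, coeFn_mulL (fourier m) h,
    coeFn_mulL (fourier (m - n)) h] with θ h1 h2 h3
  rw [h1, h2, h3, sub_eq_add_neg, fourier_add, fourier_neg]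
  simp only [RCLike.inner_apply, map_mul]
  ring

theorem inner_fourierLp (n : ℤ) (g : L2Circle) :
    inner ℂ (fourierLp 2 n) g = fourierCoeff g n := by
  rw [← fourierBasis_repr, HilbertBasis.repr_apply_apply, coe_fourierBasis]

theorem fourierCoeff_mulL_fourier (m n : ℤ) (g : L2Circle) :
    fourierCoeff (mulL (fourier m) g) n = fourierCoeff g (n - m) := by
  rw [← inner_fourierLp, ← inner_fourierLp]
  have := mulL_fourier_fourierLp m (n - m)
  rw [add_sub_cancel] at this
  rw [← this, inner_mulL_fourier, sub_self, fourier_zero_eq_one, mulL_one]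

theorem fourierCoeff_fourierLp (m n : ℤ) :
    fourierCoeff (fourierLp 2 m : L2Circle) n = if n = m then 1 else 0 := by
  rw [← inner_fourierLp, orthonormal_iff_ite.1 orthonormal_fourier]

/-- The Hardy space of the circle: the square-integrable functions whose Fourier coefficients with
negative index vanish. -/
noncomputable def hardySpace : Submodule ℂ L2Circle :=
  (Submodule.span ℂ {y | ∃ k : ℤ, k < 0 ∧ y = fourierLp 2 k})ᗮ

theorem mem_hardySpace {g : L2Circle} : g ∈ hardySpace ↔ ∀ n < 0, fourierCoeff g n = 0 := by
  simp only [← inner_fourierLp]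
  constructor
  · intro hg n hn
    exact hg _ (Submodule.subset_span ⟨n, hn, rfl⟩)
  · intro h
    refine (Submodule.mem_orthogonal _ _).2 fun u hu => ?_
    induction hu using Submodule.span_induction with
    | mem u hu =>
      obtain ⟨k, hk, rfl⟩ := hu
      exact h k hk
    | zero => exact inner_zero_left _
    | add u v _ _ hu hv => rw [inner_add_left, hu, hv, add_zero]
    | smul c u _ hu => rw [inner_smul_left, hu, mul_zero]

theorem isClosed_hardySpace : IsClosed (hardySpace : Set L2Circle) :=
  Submodule.isClosed_orthogonal _

/-! ### The model sequence and its prediction error -/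

/-- The sequence `θ ↦ exp (-i k θ) g θ` of square-integrable functions. -/
noncomputable def rotations (g : L2Circle) (k : ℤ) : L2Circle := mulL (fourier (-k)) g

theorem past_rotations_le {g : L2Circle} (hg : g ∈ hardySpace) :
    past (rotations g) 0 ≤ hardySpace := by
  refine Submodule.topologicalClosure_minimal _ (Submodule.span_le.2 ?_) isClosed_hardySpace
  rintro _ ⟨k, hk, rfl⟩
  refine mem_hardySpace.2 fun n hn => ?_
  rw [rotations, fourierCoeff_mulL_fourier]
  exact mem_hardySpace.1 hg _ (by omega)

theorem mulL_fourier_mem_past (g : L2Circle) {n k : ℤ} (hn : 0 ≤ n) {h : L2Circle}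
    (hh : h ∈ past (rotations g) k) : mulL (fourier n) h ∈ past (rotations g) k := by
  refine map_mem_closure (f := mulL (fourier n)) (by fun_prop) hh fun u hu => ?_
  change u ∈ Submodule.span ℂ _ at hu
  change _ ∈ Submodule.span ℂ _
  induction hu using Submodule.span_induction with
  | mem u hu =>
    obtain ⟨j, hj, rfl⟩ := hu
    refine Submodule.subset_span ⟨j - n, by omega, ?_⟩
    rw [rotations, rotations, ← mulL_mul, fourier_mul_fourier]
    congr 3
    ring
  | zero => rw [map_zero]; exact zero_mem _
  | add u v _ _ hu hv => rw [map_add]; exact add_mem hu hv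
  | smul c u _ hu => rw [map_smul]; exact Submodule.smul_mem _ _ hu

/-- If the closed span of the functions `exp (i n θ) g θ`, `n ≥ 0`, contains the constants, it is
the Hardy space. -/
theorem past_rotations_eq {g : L2Circle} (hg : g ∈ hardySpace)
    (h1 : fourierLp 2 0 ∈ past (rotations g) 0) : past (rotations g) 0 = hardySpace := by
  refine le_antisymm (past_rotations_le hg) fun h hh => ?_
  have hcl : IsClosed (past (rotations g) 0 : Set L2Circle) :=
    Submodule.isClosed_topologicalClosure _
  refine hcl.mem_of_tendsto (hasSum_fourier_series_L2 h) (Eventually.of_forall fun s => ?_)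
  refine Submodule.sum_mem _ fun n _ => ?_
  rcases lt_or_ge n 0 with hn | hn
  · rw [mem_hardySpace.1 hh n hn, zero_smul]
    exact zero_mem _
  · refine Submodule.smul_mem _ _ ?_
    have := mulL_fourier_mem_past g hn h1
    rwa [mulL_fourier_fourierLp, add_zero] at this

/-- Since the past is the Hardy space, the prediction residual is the negative-frequency part of
e^{-iLθ}g, and Parseval gives its norm. -/
theorem predictionError_rotations_sq {g : L2Circle} (hg : g ∈ hardySpace)
    (h1 : fourierLp 2 0 ∈ past (rotations g) 0) (L : ℕ) :
    predictionError (rotations g) L ^ 2 = ∑ n ∈ Finset.range L, ‖fourierCoeff g (n : ℤ)‖ ^ 2 := by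
  set e : L2Circle := ∑ n ∈ Finset.range L, fourierCoeff g (n : ℤ) • fourierLp 2 ((n : ℤ) - L)
    with he
  have hcoeff : ∀ k : ℤ, fourierCoeff e k =
      ∑ n ∈ Finset.range L, fourierCoeff g (n : ℤ) * if k = (n : ℤ) - L then 1 else 0 := by
    intro k
    rw [← inner_fourierLp, he, inner_sum]
    refine Finset.sum_congr rfl fun n _ => ?_
    rw [inner_smul_right, inner_fourierLp, fourierCoeff_fourierLp]
  have hmem : rotations g L - e ∈ past (rotations g) 0 := by
    rw [past_rotations_eq hg h1, mem_hardySpace]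
    intro k hk
    rw [← inner_fourierLp, inner_sub_right, inner_fourierLp, inner_fourierLp, rotations,
      fourierCoeff_mulL_fourier, hcoeff, sub_neg_eq_add, sub_eq_zero]
    -- The k-th coefficient of e^{-iLθ}g is that of g at k + L: it vanishes for k < -L, and for -L ≤
    -- k < 0 it is cancelled by the term n = k + L of `e`.
    rcases lt_or_ge (k + L) 0 with hkL | hkL
    · rw [mem_hardySpace.1 hg _ hkL, Finset.sum_eq_zero]
      intro n _
      rw [if_neg (by omega), mul_zero]
    · rw [Finset.sum_eq_single (k + L).toNat, if_pos (by omega), mul_one]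
      · congr 1; omega
      · intro n _ hn
        rw [if_neg (by omega), mul_zero]
      · intro hn
        rw [Finset.mem_range] at hn
        omega
  have horth : e ∈ (past (rotations g) 0)ᗮ := by
    rw [past_rotations_eq hg h1, he]
    refine Submodule.sum_mem _ fun n hn => Submodule.smul_mem _ _ ?_
    rw [Finset.mem_range] at hn
    exact Submodule.le_orthogonal_orthogonal _ (Submodule.subset_span ⟨_, by omega, rfl⟩)
  have hproj : (past (rotations g) 0).starProjection (rotations g L) = rotations g L - e :=
    Submodule.eq_starProjection_of_mem_orthogonal hmem (by rwa [sub_sub_cancel])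
  rw [predictionError, hproj, sub_sub_cancel, he]
  have hon : Orthonormal ℂ fun n : ℕ => (fourierLp 2 ((n : ℤ) - L) : L2Circle) :=
    orthonormal_fourier.comp _ fun a b h => by simpa using h
  rw [@norm_sq_eq_re_inner ℂ, hon.inner_sum, map_sum]
  refine Finset.sum_congr rfl fun n _ => ?_
  rw [RCLike.conj_mul]
  norm_cast

/-! ### The disc algebra, its mean value and exponentials -/

/-- The mean value of a continuous function on the circle. -/
noncomputable def meanL : C(UnitCircle, ℂ) →L[ℂ] ℂ :=
  (innerSL ℂ (fourierLp 2 0 : L2Circle)).comp (ContinuousMap.toLp 2 haarAddCircle ℂ)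

theorem meanL_eq_integral (q : C(UnitCircle, ℂ)) : meanL q = ∫ θ, q θ ∂haarAddCircle := by
  change inner ℂ (fourierLp 2 0 : L2Circle) _ = _
  rw [inner_fourierLp]
  refine (fourierCoeff_toLp q 0).trans ?_
  simp [fourierCoeff]

theorem meanL_fourier (n : ℤ) : meanL (fourier n) = if n = 0 then 1 else 0 := by
  change inner ℂ (fourierLp 2 0 : L2Circle) (fourierLp 2 n) = _
  rw [orthonormal_iff_ite.1 orthonormal_fourier]
  simp [eq_comm]

theorem fourier_one_pow (n : ℕ) : (fourier 1 ^ n : C(UnitCircle, ℂ)) = fourier (n : ℤ) := by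
  induction n with
  | zero => rw [pow_zero, Nat.cast_zero, fourier_zero_eq_one]
  | succ n ih => rw [pow_succ, ih, fourier_mul_fourier, Nat.cast_succ]

theorem aeval_fourier_monomial (n : ℕ) (c : ℂ) :
    Polynomial.aeval (fourier 1 : C(UnitCircle, ℂ)) (Polynomial.monomial n c)
      = c • fourier (n : ℤ) := by
  rw [Polynomial.aeval_monomial, fourier_one_pow, Algebra.smul_def]

theorem meanL_aeval (p : Polynomial ℂ) :
    meanL (Polynomial.aeval (fourier 1) p) = p.coeff 0 := by
  induction p using Polynomial.induction_on' with
  | add p q hp hq => rw [map_add, map_add, hp, hq, Polynomial.coeff_add]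
  | monomial n c =>
    rw [aeval_fourier_monomial, map_smul, meanL_fourier, Polynomial.coeff_monomial]
    simp

/-- The disc algebra: uniform limits on the circle of polynomials. -/
noncomputable def discAlgebra : Subalgebra ℂ C(UnitCircle, ℂ) :=
  (Algebra.adjoin ℂ {fourier 1}).topologicalClosure

theorem isClosed_discAlgebra : IsClosed (discAlgebra : Set C(UnitCircle, ℂ)) :=
  Subalgebra.isClosed_topologicalClosure _

theorem discAlgebra_eq_closure : (discAlgebra : Set C(UnitCircle, ℂ)) =
    closure (Set.range (Polynomial.aeval (R := ℂ) (fourier 1 : C(UnitCircle, ℂ)))) := by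
  rw [discAlgebra, Subalgebra.topologicalClosure_coe, Algebra.adjoin_singleton_eq_range_aeval]
  rfl

theorem fourier_mem_discAlgebra {n : ℤ} (hn : 0 ≤ n) : fourier n ∈ discAlgebra := by
  obtain ⟨k, rfl⟩ := Int.eq_ofNat_of_zero_le hn
  rw [← fourier_one_pow]
  exact pow_mem (Subalgebra.le_topologicalClosure _ (Algebra.subset_adjoin (Set.mem_singleton _))) _

theorem meanL_aeval_mul_aeval (p q : Polynomial ℂ) :
    meanL (Polynomial.aeval (fourier 1) p * Polynomial.aeval (fourier 1) q) =
      meanL (Polynomial.aeval (fourier 1) p) * meanL (Polynomial.aeval (fourier 1) q) := by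
  rw [← map_mul, meanL_aeval, meanL_aeval, meanL_aeval, Polynomial.mul_coeff_zero]

theorem isClosed_meanL_mul (b : C(UnitCircle, ℂ)) :
    IsClosed {a : C(UnitCircle, ℂ) | meanL (a * b) = meanL a * meanL b} :=
  isClosed_eq (by fun_prop) (by fun_prop)

/-- The mean value is multiplicative on the disc algebra. -/
theorem meanL_mul {a b : C(UnitCircle, ℂ)} (ha : a ∈ discAlgebra) (hb : b ∈ discAlgebra) :
    meanL (a * b) = meanL a * meanL b := by
  rw [← SetLike.mem_coe, discAlgebra_eq_closure] at ha hb
  refine closure_minimal ?_ (isClosed_meanL_mul b) ha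
  rintro _ ⟨p, rfl⟩
  have h : b ∈ {b | meanL (b * Polynomial.aeval (fourier 1) p) =
      meanL b * meanL (Polynomial.aeval (fourier 1) p)} := by
    refine closure_minimal ?_ (isClosed_meanL_mul _) hb
    rintro _ ⟨q, rfl⟩
    exact meanL_aeval_mul_aeval q p
  exact (congrArg meanL (mul_comm _ _)).trans (Eq.trans h (mul_comm _ _))

theorem meanL_pow {a : C(UnitCircle, ℂ)} (ha : a ∈ discAlgebra) (n : ℕ) :
    meanL (a ^ n) = meanL a ^ n := by
  induction n with
  | zero => rw [pow_zero, pow_zero, ← fourier_zero_eq_one, meanL_fourier, if_pos rfl]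
  | succ n ih => rw [pow_succ, pow_succ, meanL_mul (pow_mem ha n) ha, ih]

/-- The exponential of a continuous function on the circle. -/
noncomputable def expC (v : C(UnitCircle, ℂ)) : C(UnitCircle, ℂ) :=
  (⟨Complex.exp, Complex.continuous_exp⟩ : C(ℂ, ℂ)).comp v

theorem continuous_expC : Continuous expC := ContinuousMap.continuous_postcomp _

theorem hasSum_cexp (z : ℂ) :
    HasSum (fun n : ℕ => ((Nat.factorial n : ℂ)⁻¹) • z ^ n) (Complex.exp z) := by
  rw [Complex.exp_eq_exp_ℂ]
  exact NormedSpace.exp_series_hasSum_exp' z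

/-- Uniform convergence of the series lets the pointwise exponential inherit membership in the
closed disc algebra and compatibility with the multiplicative mean. -/
theorem hasSum_expC (v : C(UnitCircle, ℂ)) :
    HasSum (fun n : ℕ => ((Nat.factorial n : ℂ)⁻¹) • v ^ n) (expC v) := by
  have h := NormedSpace.exp_series_hasSum_exp' (𝕂 := ℂ) v
  suffices he : expC v = NormedSpace.exp v by rwa [he]
  refine ContinuousMap.ext fun θ => ?_
  exact (hasSum_cexp (v θ)).unique (h.mapL (ContinuousMap.evalCLM ℂ θ : C(UnitCircle, ℂ) →L[ℂ] ℂ))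

theorem expC_mem_discAlgebra {a : C(UnitCircle, ℂ)} (ha : a ∈ discAlgebra) :
    expC a ∈ discAlgebra :=
  isClosed_discAlgebra.mem_of_tendsto (hasSum_expC a) <| Eventually.of_forall fun _ =>
    sum_mem fun n _ => Subalgebra.smul_mem _ (pow_mem ha n) _

theorem meanL_expC {a : C(UnitCircle, ℂ)} (ha : a ∈ discAlgebra) :
    meanL (expC a) = Complex.exp (meanL a) := by
  refine ((hasSum_expC a).mapL meanL).unique ?_
  simp only [map_smul, meanL_pow ha]
  exact hasSum_cexp _

/-! ### Szegő's inequality -/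

/-- The closed span of the functions `exp (i n θ) g θ`, `n ≥ 1`, contains `(q - q(0)) g` for all
`q` in the disc algebra. -/
theorem mulL_sub_mem_past (g : L2Circle) {q : C(UnitCircle, ℂ)} (hq : q ∈ discAlgebra) :
    mulL q g - meanL q • g ∈ past (rotations g) (-1) := by
  have hcl : IsClosed {q : C(UnitCircle, ℂ) | mulL q g - meanL q • g ∈ past (rotations g) (-1)} :=
    (Submodule.isClosed_topologicalClosure _).preimage
      (f := fun q => mulL q g - meanL q • g) (by fun_prop)
  rw [← SetLike.mem_coe, discAlgebra_eq_closure] at hq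
  refine closure_minimal ?_ hcl hq
  rintro _ ⟨p, rfl⟩
  change mulL (Polynomial.aeval _ p) g - _ ∈ past (rotations g) (-1)
  induction p using Polynomial.induction_on' with
  | add p q hp hq =>
    rw [map_add, map_add, map_add, add_apply, add_smul, add_sub_add_comm]
    exact add_mem hp hq
  | monomial n c =>
    rw [aeval_fourier_monomial, map_smul, map_smul, meanL_fourier, smul_apply,
      smul_assoc, ← smul_sub]
    refine Submodule.smul_mem _ _ ?_
    rcases Nat.eq_zero_or_pos n with rfl | hn
    · rw [Nat.cast_zero, if_pos rfl, fourier_zero_eq_one, mulL_one, one_smul, sub_self]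
      exact zero_mem _
    · rw [if_neg (by omega), zero_smul, sub_zero]
      refine Submodule.le_topologicalClosure _ (Submodule.subset_span ⟨-(n : ℤ), by omega, ?_⟩)
      rw [rotations, neg_neg]

/-- The component of `g` orthogonal to the functions `exp (i n θ) g θ`, `n ≥ 1`. -/
noncomputable def innovation (g : L2Circle) : L2Circle :=
  g - (past (rotations g) (-1)).starProjection g

theorem norm_innovation_le (g : L2Circle) {m : L2Circle} (hm : m ∈ past (rotations g) (-1)) :
    ‖innovation g‖ ≤ ‖g - m‖ := by
  rw [innovation, Submodule.starProjection_minimal]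
  exact ciInf_le ⟨0, by rintro _ ⟨w, rfl⟩; exact norm_nonneg _⟩
    (⟨m, hm⟩ : past (rotations g) (-1))

/-- The function e^{a(0)-a} lies in the disc algebra and has mean 1, so e^{a(0)-a}g differs from g
by an element of the past up to time -1 and is an admissible competitor. -/
theorem norm_innovation_le_of_mem_discAlgebra (g : L2Circle) {a : C(UnitCircle, ℂ)}
    (ha : a ∈ discAlgebra) :
    ‖innovation g‖ ≤ Real.exp (meanL a).re * ‖mulL (expC (-a)) g‖ := by
  have ha' : -a ∈ discAlgebra := neg_mem ha
  have h := mulL_sub_mem_past g (expC_mem_discAlgebra ha')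
  rw [meanL_expC ha', map_neg] at h
  have h2 := norm_innovation_le g (neg_mem (Submodule.smul_mem _ (Complex.exp (meanL a)) h))
  rw [smul_sub, smul_smul, ← Complex.exp_add, add_neg_cancel, Complex.exp_zero, one_smul,
    neg_sub, sub_sub_cancel, norm_smul, Complex.norm_exp] at h2
  exact h2

theorem norm_sq_mulL_expC (g : L2Circle) (v : C(UnitCircle, ℂ)) :
    ‖mulL (expC (-v)) g‖ ^ 2 =
      ∫ θ, Real.exp (-2 * (v θ).re) * ‖g θ‖ ^ 2 ∂haarAddCircle := by
  rw [@norm_sq_eq_re_inner ℂ, L2.inner_def, ← integral_re (L2.integrable_inner _ _)]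
  refine integral_congr_ae ?_
  filter_upwards [coeFn_mulL (expC (-v)) g] with θ h
  rw [h, ← norm_sq_eq_re_inner, norm_mul, mul_pow]
  congr 1
  change ‖Complex.exp (-(v θ))‖ ^ 2 = _
  rw [Complex.norm_exp, ← Real.exp_nat_mul, Complex.neg_re]
  congr 1
  push_cast
  ring

theorem re_meanL (v : C(UnitCircle, ℂ)) : (meanL v).re = ∫ θ, (v θ).re ∂haarAddCircle := by
  rw [meanL_eq_integral]
  exact (integral_re (𝕜 := ℂ) (v.continuous.integrable_of_hasCompactSupport
    (HasCompactSupport.of_compactSpace _))).symm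

/-- Every trigonometric polynomial has the same real part as some analytic polynomial. -/
theorem exists_mem_discAlgebra_re_eq {v : C(UnitCircle, ℂ)}
    (hv : v ∈ Submodule.span ℂ (Set.range (fourier (T := 2 * Real.pi)))) :
    ∃ a ∈ discAlgebra, ∀ θ, (a θ).re = (v θ).re := by
  -- Taking real parts is not complex linear; the free factor c absorbs the scalars met in the span
  -- induction.
  suffices h : ∀ c : ℂ, ∃ a ∈ discAlgebra, ∀ θ, (a θ).re = (c * v θ).re by
    simpa using h 1
  induction hv using Submodule.span_induction with
  | mem v hv =>
    obtain ⟨n, rfl⟩ := hv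
    intro c
    rcases le_total 0 n with hn | hn
    · exact ⟨c • fourier n, Subalgebra.smul_mem _ (fourier_mem_discAlgebra hn) _, fun θ => rfl⟩
    · refine ⟨(starRingEnd ℂ c) • fourier (-n),
        Subalgebra.smul_mem _ (fourier_mem_discAlgebra (by omega)) _, fun θ => ?_⟩
      rw [ContinuousMap.smul_apply, fourier_neg, smul_eq_mul, ← map_mul, Complex.conj_re]
  | zero => exact fun c => ⟨0, zero_mem _, fun θ => by simp⟩
  | add u v _ _ hu hv =>
    intro c
    obtain ⟨a, ha, hau⟩ := hu c
    obtain ⟨b, hb, hbv⟩ := hv c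
    refine ⟨a + b, add_mem ha hb, fun θ => ?_⟩
    rw [ContinuousMap.add_apply, ContinuousMap.add_apply, mul_add, Complex.add_re, Complex.add_re,
      hau, hbv]
  | smul d v _ hv =>
    intro c
    obtain ⟨a, ha, hav⟩ := hv (c * d)
    refine ⟨a, ha, fun θ => ?_⟩
    rw [hav, ContinuousMap.smul_apply, smul_eq_mul, mul_assoc]

/-- Both factors on the right depend only on the real part of the exponent, so the disc algebra
bound covers trigonometric polynomials, which are uniformly dense. -/
theorem norm_innovation_le_of_complex_continuous (g : L2Circle) (v : C(UnitCircle, ℂ)) :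
    ‖innovation g‖ ≤ Real.exp (meanL v).re * ‖mulL (expC (-v)) g‖ := by
  have hcl : IsClosed {v : C(UnitCircle, ℂ) |
      ‖innovation g‖ ≤ Real.exp (meanL v).re * ‖mulL (expC (-v)) g‖} := by
    have := continuous_expC
    refine isClosed_le continuous_const ?_
    fun_prop
  have hv : v ∈ (Submodule.span ℂ (Set.range (fourier (T := 2 * Real.pi)))).topologicalClosure := by
    rw [span_fourier_closure_eq_top]
    trivial
  refine closure_minimal (fun w hw => ?_) hcl hv
  obtain ⟨a, ha, haw⟩ := exists_mem_discAlgebra_re_eq hw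
  have h1 := norm_innovation_le_of_mem_discAlgebra g ha
  have h2 : ‖mulL (expC (-a)) g‖ = ‖mulL (expC (-w)) g‖ := by
    rw [← sq_eq_sq₀ (norm_nonneg _) (norm_nonneg _), norm_sq_mulL_expC, norm_sq_mulL_expC]
    simp only [haw]
  rw [re_meanL] at h1
  simp only [haw] at h1
  rw [← re_meanL, h2] at h1
  exact h1

theorem norm_innovation_sq_le_of_continuous (g : L2Circle) (u : C(UnitCircle, ℝ)) :
    ‖innovation g‖ ^ 2 ≤ Real.exp (2 * ∫ θ, u θ ∂haarAddCircle) *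
      ∫ θ, Real.exp (-2 * u θ) * ‖g θ‖ ^ 2 ∂haarAddCircle := by
  let v : C(UnitCircle, ℂ) := (⟨Complex.ofReal, Complex.continuous_ofReal⟩ : C(ℝ, ℂ)).comp u
  have h := pow_le_pow_left₀ (norm_nonneg _) (norm_innovation_le_of_complex_continuous g v) 2
  rw [mul_pow, norm_sq_mulL_expC, re_meanL, ← Real.exp_nat_mul] at h
  exact_mod_cast h

theorem integrable_norm_sq (g : L2Circle) : Integrable (fun θ => ‖g θ‖ ^ 2) haarAddCircle :=
  (memLp_two_iff_integrable_sq_norm (Lp.aestronglyMeasurable g)).1 (Lp.memLp g)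

theorem exists_seq_continuous_tendsto_ae {w : UnitCircle → ℝ} (hw : Integrable w haarAddCircle) :
    ∃ u : ℕ → C(UnitCircle, ℝ),
      ∀ᵐ θ ∂haarAddCircle, Tendsto (fun n => u n θ) atTop (𝓝 (w θ)) := by
  have hex : ∀ n : ℕ, ∃ u : BoundedContinuousFunction UnitCircle ℝ,
      eLpNorm (w - (u : UnitCircle → ℝ)) 1 haarAddCircle ≤ ENNReal.ofReal (1 / ((n : ℝ) + 1)) ∧
        MemLp u 1 haarAddCircle := fun n =>
    (memLp_one_iff_integrable.2 hw).exists_boundedContinuous_eLpNorm_sub_le ENNReal.one_ne_top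
      (ENNReal.ofReal_pos.2 (by positivity)).ne'
  choose u hu _ using hex
  have hlim : Tendsto (fun n => eLpNorm ((u n : UnitCircle → ℝ) - w) 1 haarAddCircle) atTop
      (𝓝 0) := by
    have h0 := (ENNReal.continuous_ofReal.tendsto 0).comp
      (tendsto_one_div_add_atTop_nhds_zero_nat (𝕜 := ℝ))
    rw [ENNReal.ofReal_zero] at h0
    refine tendsto_of_tendsto_of_tendsto_of_le_of_le tendsto_const_nhds h0 (fun _ => zero_le)
      fun n => ?_
    simp only
    rw [eLpNorm_sub_comm]
    exact hu n
  obtain ⟨ns, _, hns⟩ := (tendstoInMeasure_of_tendsto_eLpNorm one_ne_zero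
    (fun n => (u n).continuous.aestronglyMeasurable) hw.1 hlim).exists_seq_tendsto_ae
  exact ⟨fun n => (u (ns n)).toContinuousMap, hns⟩

theorem norm_innovation_sq_le_of_bounded (g : L2Circle) {w : UnitCircle → ℝ}
    (hw : AEStronglyMeasurable w haarAddCircle) {k : ℝ} (hk : ∀ θ, |w θ| ≤ k) :
    ‖innovation g‖ ^ 2 ≤ Real.exp (2 * ∫ θ, w θ ∂haarAddCircle) *
      ∫ θ, Real.exp (-2 * w θ) * ‖g θ‖ ^ 2 ∂haarAddCircle := by
  have hwint : Integrable w haarAddCircle :=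
    Integrable.of_bound hw k (Eventually.of_forall hk)
  have hk0 : 0 ≤ k := (abs_nonneg _).trans (hk 0)
  obtain ⟨u, hu⟩ := exists_seq_continuous_tendsto_ae hwint
  -- L¹ approximants need not be bounded; clipping them at the bound of `w` keeps the limit and
  -- makes dominated convergence apply to the exponentials.
  let clip : C(ℝ, ℝ) := ⟨fun t => max (-k) (min k t), by fun_prop⟩
  have hclip : ∀ t, |clip t| ≤ k := fun t =>
    abs_le.2 ⟨le_max_left _ _, max_le (by linarith) (min_le_left _ _)⟩
  have hclip_eq : ∀ θ, clip (w θ) = w θ := fun θ => by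
    have := abs_le.1 (hk θ)
    change max (-k) (min k (w θ)) = _
    rw [min_eq_right this.2, max_eq_right this.1]
  have hlim : ∀ᵐ θ ∂haarAddCircle, Tendsto (fun n => clip (u n θ)) atTop (𝓝 (w θ)) := by
    filter_upwards [hu] with θ h
    have := (clip.continuous.tendsto (w θ)).comp h
    rwa [hclip_eq] at this
  have h1 : Tendsto (fun n => ∫ θ, clip (u n θ) ∂haarAddCircle) atTop
      (𝓝 (∫ θ, w θ ∂haarAddCircle)) := by
    refine tendsto_integral_of_dominated_convergence (fun _ => k)
      (fun n => (clip.comp (u n)).continuous.aestronglyMeasurable) (integrable_const k)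
      (fun n => Eventually.of_forall fun θ => hclip _) hlim
  have h2 : Tendsto (fun n => ∫ θ, Real.exp (-2 * clip (u n θ)) * ‖g θ‖ ^ 2 ∂haarAddCircle) atTop
      (𝓝 (∫ θ, Real.exp (-2 * w θ) * ‖g θ‖ ^ 2 ∂haarAddCircle)) := by
    refine tendsto_integral_of_dominated_convergence (fun θ => Real.exp (2 * k) * ‖g θ‖ ^ 2)
      (fun n => ?_) ((integrable_norm_sq g).const_mul _)
      (fun n => Eventually.of_forall fun θ => ?_) ?_
    · exact (Continuous.aestronglyMeasurable (by fun_prop)).mul (integrable_norm_sq g).1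
    · rw [Real.norm_of_nonneg (by positivity)]
      have := abs_le.1 (hclip (u n θ))
      exact mul_le_mul_of_nonneg_right (Real.exp_le_exp.2 (by linarith)) (sq_nonneg _)
    · filter_upwards [hlim] with θ h
      exact ((Real.continuous_exp.tendsto _).comp (h.const_mul (-2))).mul_const _
  refine ge_of_tendsto' (((Real.continuous_exp.tendsto _).comp (h1.const_mul 2)).mul h2) fun n => ?_
  exact norm_innovation_sq_le_of_continuous g (clip.comp (u n))

theorem exp_two_mul_eq_sq (t : ℝ) : Real.exp (2 * t) = Real.exp t ^ 2 := by
  rw [two_mul, Real.exp_add, sq]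

/-- Szegő's inequality. -/
theorem norm_innovation_le_exp (g : L2Circle) (hg0 : ∀ᵐ θ ∂haarAddCircle, g θ ≠ 0)
    (hlog : Integrable (fun θ => Real.log ‖g θ‖) haarAddCircle) :
    ‖innovation g‖ ≤ Real.exp (∫ θ, Real.log ‖g θ‖ ∂haarAddCircle) := by
  let w : ℕ → UnitCircle → ℝ := fun k θ => max (-(k : ℝ)) (min k (Real.log ‖g θ‖))
  have hwm : ∀ k, AEStronglyMeasurable (w k) haarAddCircle := fun k =>
    (show Continuous fun t : ℝ => max (-(k : ℝ)) (min k t) by fun_prop).comp_aestronglyMeasurable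
      hlog.1
  have hwk : ∀ k θ, |w k θ| ≤ k := fun k θ =>
    abs_le.2 ⟨le_max_left _ _, max_le (by linarith [k.cast_nonneg (α := ℝ)]) (min_le_left _ _)⟩
  have hwlog : ∀ k θ, |w k θ| ≤ |Real.log ‖g θ‖| := by
    intro k θ
    have hk := k.cast_nonneg (α := ℝ)
    refine abs_le.2 ⟨?_, ?_⟩
    · refine (le_min ?_ ?_).trans (le_max_right _ _)
      · linarith [abs_nonneg (Real.log ‖g θ‖)]
      · exact neg_abs_le _
    · refine max_le ?_ ((min_le_right _ _).trans (le_abs_self _))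
      linarith [abs_nonneg (Real.log ‖g θ‖)]
  have hev : ∀ θ, ∀ᶠ k in atTop, w k θ = Real.log ‖g θ‖ := by
    intro θ
    filter_upwards [eventually_ge_atTop ⌈|Real.log ‖g θ‖|⌉₊] with k hk
    have := abs_le.1 (Nat.ceil_le.1 hk)
    simp only [w]
    rw [min_eq_right this.2, max_eq_right this.1]
  have h1 : Tendsto (fun k => ∫ θ, w k θ ∂haarAddCircle) atTop
      (𝓝 (∫ θ, Real.log ‖g θ‖ ∂haarAddCircle)) :=
    tendsto_integral_of_dominated_convergence (fun θ => |Real.log ‖g θ‖|) hwm hlog.abs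
      (fun k => Eventually.of_forall fun θ => hwlog k θ)
      (Eventually.of_forall fun θ => tendsto_const_nhds.congr' ((hev θ).mono fun k hk => hk.symm))
  have h2 : Tendsto (fun k => ∫ θ, Real.exp (-2 * w k θ) * ‖g θ‖ ^ 2 ∂haarAddCircle) atTop
      (𝓝 (∫ _, (1 : ℝ) ∂(haarAddCircle : Measure UnitCircle))) := by
    have hbound : Integrable (fun θ => 1 + ‖g θ‖ ^ 2) haarAddCircle :=
      (integrable_const (1 : ℝ)).add (integrable_norm_sq g)
    refine tendsto_integral_of_dominated_convergence (fun θ => 1 + ‖g θ‖ ^ 2) (fun k => ?_)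
      hbound (fun k => ?_) ?_
    · have hexp : Continuous fun t : ℝ => Real.exp (-2 * t) := by fun_prop
      exact (hexp.comp_aestronglyMeasurable (hwm k)).mul (integrable_norm_sq g).1
    · filter_upwards [hg0] with θ hθ
      rw [Real.norm_of_nonneg (by positivity)]
      have hpos : 0 < ‖g θ‖ := norm_pos_iff.2 hθ
      -- If log|g| ≤ k, then w ≥ log|g| and the integrand is at most 1; otherwise w ≥ 0 and it is at
      -- most |g|².
      rcases le_total (Real.log ‖g θ‖) k with h | h
      · have hle : Real.log ‖g θ‖ ≤ w k θ := by
          simp only [w]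
          rw [min_eq_right h]
          exact le_max_right _ _
        have : ‖g θ‖ ^ 2 = Real.exp (2 * Real.log ‖g θ‖) := by
          rw [exp_two_mul_eq_sq, Real.exp_log hpos]
        have h3 : Real.exp (-2 * w k θ) * ‖g θ‖ ^ 2 ≤ 1 := by
          rw [this, ← Real.exp_add]
          exact Real.exp_le_one_iff.2 (by linarith)
        linarith [sq_nonneg ‖g θ‖]
      · have hk := k.cast_nonneg (α := ℝ)
        have hle : 0 ≤ w k θ := by
          simp only [w]
          rw [min_eq_left h]
          exact hk.trans (le_max_right _ _)
        have h3 : Real.exp (-2 * w k θ) * ‖g θ‖ ^ 2 ≤ 1 * ‖g θ‖ ^ 2 :=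
          mul_le_mul_of_nonneg_right (Real.exp_le_one_iff.2 (by linarith)) (sq_nonneg _)
        linarith
    · filter_upwards [hg0] with θ hθ
      refine tendsto_const_nhds.congr' ((hev θ).mono fun k hk => ?_)
      simp only
      rw [hk, neg_mul, Real.exp_neg, exp_two_mul_eq_sq, Real.exp_log (norm_pos_iff.2 hθ),
        inv_mul_cancel₀ (pow_ne_zero 2 (norm_ne_zero_iff.2 hθ))]
  have h3 : ‖innovation g‖ ^ 2 ≤ Real.exp (2 * ∫ θ, Real.log ‖g θ‖ ∂haarAddCircle) *
      ∫ _, (1 : ℝ) ∂(haarAddCircle : Measure UnitCircle) :=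
    ge_of_tendsto' (((Real.continuous_exp.tendsto _).comp (h1.const_mul 2)).mul h2) fun k =>
      norm_innovation_sq_le_of_bounded g (hwm k) (hwk k)
  rw [integral_const, probReal_univ, one_smul, mul_one, exp_two_mul_eq_sq] at h3
  exact le_of_sq_le_sq h3 (Real.exp_pos _).le

/-! ### Cyclicity of outer functions -/

theorem past_mono {H : Type*} [NormedAddCommGroup H] [InnerProductSpace ℂ H] (x : ℤ → H)
    {m n : ℤ} (hmn : m ≤ n) : past x m ≤ past x n :=
  Submodule.topologicalClosure_mono <| Submodule.span_mono <| by
    rintro _ ⟨k, hk, rfl⟩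
    exact ⟨k, hk.trans hmn, rfl⟩

theorem fourierCoeff_zero_eq_zero_of_mem_past {g h : L2Circle} (hg : g ∈ hardySpace)
    (hh : h ∈ past (rotations g) (-1)) : fourierCoeff h 0 = 0 := by
  have hcl : IsClosed {h : L2Circle | inner ℂ (fourierLp 2 0) h = 0} :=
    isClosed_eq (by fun_prop) continuous_const
  rw [← inner_fourierLp]
  refine closure_minimal (fun u hu => ?_) hcl hh
  change u ∈ Submodule.span ℂ _ at hu
  change inner ℂ _ _ = _
  induction hu using Submodule.span_induction with
  | mem u hu =>
    obtain ⟨k, hk, rfl⟩ := hu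
    rw [inner_fourierLp, rotations, fourierCoeff_mulL_fourier]
    exact mem_hardySpace.1 hg _ (by omega)
  | zero => exact inner_zero_right _
  | add u v _ _ hu hv => rw [inner_add_right, hu, hv, add_zero]
  | smul c u _ hu => rw [inner_smul_right, hu, mul_zero]

/-- Outer functions are cyclic: the closed span of `exp (i n θ) g θ`, `n ≥ 0`, contains the
constants. -/
theorem one_mem_past_rotations {g : L2Circle} (hg : g ∈ hardySpace)
    (hg0 : ∀ᵐ θ ∂haarAddCircle, g θ ≠ 0)
    (hlog : Integrable (fun θ => Real.log ‖g θ‖) haarAddCircle)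
    (houter : ‖fourierCoeff g 0‖ = Real.exp (∫ θ, Real.log ‖g θ‖ ∂haarAddCircle)) :
    fourierLp 2 0 ∈ past (rotations g) 0 := by
  have hproj : (past (rotations g) (-1)).starProjection g ∈ past (rotations g) (-1) :=
    Submodule.starProjection_apply_mem _ _
  set c := fourierCoeff g 0 with hc
  have hc0 : c ≠ 0 := norm_pos_iff.1 (houter ▸ Real.exp_pos _)
  have hcoeff : inner ℂ (fourierLp 2 0) (innovation g) = c := by
    rw [innovation, inner_sub_right, inner_fourierLp, inner_fourierLp,
      fourierCoeff_zero_eq_zero_of_mem_past hg hproj, sub_zero]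
  have hle : ‖innovation g‖ ≤ ‖c‖ := houter ▸ norm_innovation_le_exp g hg0 hlog
  -- Equality case of Cauchy–Schwarz: expanding ‖I - c‖² gives ‖I‖² - |c|² ≤ 0.
  have heq : innovation g = c • fourierLp 2 0 := by
    have h := @norm_sub_sq ℂ _ _ _ _ (innovation g) (c • fourierLp 2 0)
    have h1 : RCLike.re (inner ℂ (innovation g) (c • (fourierLp 2 0 : L2Circle))) = ‖c‖ ^ 2 := by
      rw [inner_smul_right, ← inner_conj_symm, hcoeff, RCLike.mul_conj]
      norm_cast
    have h2 : ‖c • (fourierLp 2 0 : L2Circle)‖ = ‖c‖ := by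
      rw [norm_smul, orthonormal_fourier.1, mul_one]
    rw [h1, h2] at h
    have h3 := pow_le_pow_left₀ (norm_nonneg _) hle 2
    have h4 : ‖innovation g - c • fourierLp 2 0‖ ^ 2 = 0 :=
      le_antisymm (by linarith) (sq_nonneg _)
    exact sub_eq_zero.1 (norm_eq_zero.1 (pow_eq_zero_iff two_ne_zero |>.1 h4))
  have hmem : innovation g ∈ past (rotations g) 0 := by
    refine sub_mem (Submodule.le_topologicalClosure _ (Submodule.subset_span ⟨0, le_rfl, ?_⟩))
      (past_mono _ (by norm_num) hproj)
    rw [rotations, neg_zero, fourier_zero_eq_one, mulL_one]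
  have := Submodule.smul_mem _ c⁻¹ hmem
  rwa [heq, smul_smul, inv_mul_cancel₀ hc0, one_smul] at this

/-! ### Boundary values of functions in H₂ -/

theorem ae_volume_iff_ae_haarAddCircle {p : UnitCircle → Prop} :
    (∀ᵐ θ, p θ) ↔ ∀ᵐ θ ∂haarAddCircle, p θ := by
  rw [volume_eq_smul_haarAddCircle,
    Measure.ae_ennreal_smul_measure_iff (ENNReal.ofReal_pos.2 Real.two_pi_pos).ne']

theorem norm_sq_eq_integral (g : L2Circle) :
    ‖g‖ ^ 2 = ∫ θ, ‖g θ‖ ^ 2 ∂haarAddCircle := by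
  rw [@norm_sq_eq_re_inner ℂ, L2.inner_def, ← integral_re (L2.integrable_inner _ _)]
  simp only [← norm_sq_eq_re_inner]

theorem hasSum_norm_sq (g : L2Circle) :
    HasSum (fun k => ‖fourierCoeff g k‖ ^ 2) (‖g‖ ^ 2) := by
  rw [norm_sq_eq_integral]
  exact hasSum_sq_fourierCoeff g

theorem norm_ofReal_mul_fourier_one {r : ℝ} (hr0 : 0 ≤ r) (θ : UnitCircle) :
    ‖(r : ℂ) * fourier 1 θ‖ = r := by
  rw [norm_mul, fourier_one, Circle.norm_coe, mul_one, Complex.norm_real, Real.norm_of_nonneg hr0]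

/-- The Taylor coefficients at the origin. -/
noncomputable def taylorCoeff (F : ℂ → ℂ) (n : ℕ) : ℂ :=
  (Nat.factorial n : ℂ)⁻¹ * iteratedDeriv n F 0

theorem hasSum_taylorCoeff {F : ℂ → ℂ} (hF : DifferentiableOn ℂ F (Metric.ball 0 1)) {z : ℂ}
    (hz : ‖z‖ < 1) : HasSum (fun n => taylorCoeff F n * z ^ n) (F z) := by
  have h := Complex.hasSum_taylorSeries_on_ball hF (mem_ball_zero_iff.2 hz)
  have hterm : (fun n => taylorCoeff F n * z ^ n) = fun n : ℕ =>
      (Nat.factorial n : ℂ)⁻¹ • (z - 0) ^ n • iteratedDeriv n F 0 := by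
    funext n
    rw [taylorCoeff, sub_zero, smul_eq_mul, smul_eq_mul]
    ring
  rwa [hterm]

/-- The sequence of Fourier coefficients of the boundary function of `F`. -/
noncomputable def boundaryCoeff (F : ℂ → ℂ) (k : ℤ) : ℂ :=
  if 0 ≤ k then taylorCoeff F k.toNat else 0

/-- The restriction of `F` to the circle of radius `r` as a square-integrable function. -/
theorem exists_circle_restriction {F : ℂ → ℂ} (hF : DifferentiableOn ℂ F (Metric.ball 0 1)) {r : ℝ}
    (hr0 : 0 ≤ r) (hr1 : r < 1) :
    ∃ P : L2Circle, (P =ᵐ[haarAddCircle] fun θ => F (r * fourier 1 θ)) ∧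
      ∀ k, fourierCoeff P k = (r : ℂ) ^ k.toNat * boundaryCoeff F k := by
  have hsum : Summable fun n : ℕ =>
      (taylorCoeff F n * (r : ℂ) ^ n) • (fourier (n : ℤ) : C(UnitCircle, ℂ)) := by
    refine Summable.of_norm ?_
    have h := (hasSum_taylorCoeff hF (z := (r : ℂ))
      (by rwa [Complex.norm_real, Real.norm_of_nonneg hr0])).summable.norm
    refine h.congr fun n => ?_
    rw [norm_smul, fourier_norm, mul_one]
  obtain ⟨q, hq⟩ := hsum
  have hqF : ∀ θ, q θ = F (r * fourier 1 θ) := fun θ => by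
    refine (hq.mapL (ContinuousMap.evalCLM ℂ θ : C(UnitCircle, ℂ) →L[ℂ] ℂ)).unique ?_
    convert hasSum_taylorCoeff hF (z := r * fourier 1 θ)
      (by rwa [norm_ofReal_mul_fourier_one hr0]) using 2 with n
    change (taylorCoeff F n * (r : ℂ) ^ n) * fourier (n : ℤ) θ = _
    rw [← fourier_one_pow, ContinuousMap.pow_apply, mul_pow, mul_assoc]
  refine ⟨ContinuousMap.toLp 2 haarAddCircle ℂ q, ?_, fun k => ?_⟩
  · filter_upwards [ContinuousMap.coeFn_toLp (p := 2) (𝕜 := ℂ)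
      (haarAddCircle : Measure UnitCircle) q] with θ h
    rw [h, hqF]
  · have h := (hq.mapL (ContinuousMap.toLp 2 haarAddCircle ℂ)).mapL
      (innerSL ℂ (fourierLp 2 k : L2Circle))
    rw [← inner_fourierLp]
    refine h.unique ?_
    have hterm : ∀ n : ℕ, innerSL ℂ (fourierLp 2 k : L2Circle)
        (ContinuousMap.toLp 2 haarAddCircle ℂ
          ((taylorCoeff F n * (r : ℂ) ^ n) • (fourier (n : ℤ) : C(UnitCircle, ℂ)))) =
        if k = (n : ℤ) then taylorCoeff F n * (r : ℂ) ^ n else 0 := by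
      intro n
      rw [map_smul, map_smul]
      change _ • inner ℂ (fourierLp 2 k : L2Circle) (fourierLp 2 (n : ℤ)) = _
      rw [orthonormal_iff_ite.1 orthonormal_fourier]
      simp
    simp only [hterm]
    rcases lt_or_ge k 0 with hk | hk
    · rw [boundaryCoeff, if_neg (by omega), mul_zero]
      convert hasSum_zero using 2 with n
      rw [if_neg (by omega)]
    · obtain ⟨m, rfl⟩ := Int.eq_ofNat_of_zero_le hk
      rw [boundaryCoeff, if_pos hk, Int.toNat_natCast, mul_comm]
      have h2 := hasSum_single (f := fun n : ℕ =>
        if (m : ℤ) = (n : ℤ) then taylorCoeff F n * (r : ℂ) ^ n else 0) m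
        fun n hn => if_neg (by omega)
      simp only [if_true] at h2
      exact h2

/-- Bessel's inequality on the circle of radius r, followed by r → 1 in a finite sum. The factor
(2π)⁻¹ passes from arc length to normalized measure. -/
theorem sum_boundaryCoeff_le {F : ℂ → ℂ} (hF : DifferentiableOn ℂ F (Metric.ball 0 1)) {C : ℝ}
    (hC : ∀ r : ℝ, 0 ≤ r → r < 1 → ∫ θ : UnitCircle, ‖F (r * fourier 1 θ)‖ ^ 2 ≤ C)
    (s : Finset ℤ) : ∑ k ∈ s, ‖boundaryCoeff F k‖ ^ 2 ≤ (2 * Real.pi)⁻¹ * C := by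
  have hr : ∀ r : ℝ, 0 ≤ r → r < 1 →
      ∑ k ∈ s, ‖(r : ℂ) ^ k.toNat * boundaryCoeff F k‖ ^ 2 ≤ (2 * Real.pi)⁻¹ * C := by
    intro r hr0 hr1
    obtain ⟨P, hP, hcoeff⟩ := exists_circle_restriction hF hr0 hr1
    simp only [← hcoeff]
    refine (sum_le_hasSum s (fun _ _ => sq_nonneg _) (hasSum_norm_sq P)).trans ?_
    have hint : ∫ θ, ‖P θ‖ ^ 2 ∂haarAddCircle =
        ∫ θ, ‖F (r * fourier 1 θ)‖ ^ 2 ∂haarAddCircle :=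
      integral_congr_ae (hP.fun_comp fun z => ‖z‖ ^ 2)
    rw [norm_sq_eq_integral, hint, integral_haarAddCircle, smul_eq_mul]
    exact mul_le_mul_of_nonneg_left (hC r hr0 hr1) (by positivity)
  have hcont : Continuous fun r : ℝ => ∑ k ∈ s, ‖(r : ℂ) ^ k.toNat * boundaryCoeff F k‖ ^ 2 := by
    fun_prop
  have hlim := (hcont.tendsto 1).mono_left (nhdsWithin_le_nhds (s := Set.Iio 1))
  simp only [Complex.ofReal_one, one_pow, one_mul] at hlim
  refine le_of_tendsto hlim ?_
  filter_upwards [Ioo_mem_nhdsLT zero_lt_one] with r h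
  exact hr r h.1.le h.2

/-- The boundary function of a function in `H₂` belongs to the Hardy space of the circle, and its
zeroth Fourier coefficient is the value at the origin. -/
theorem exists_mem_hardySpace {F : ℂ → ℂ} (hF : IsHardyTwo F) {g : UnitCircle → ℂ}
    (hg : IsBoundaryFunction F g) :
    ∃ G ∈ hardySpace, G =ᵐ[haarAddCircle] g ∧ fourierCoeff G 0 = F 0 := by
  obtain ⟨hdiff, C, hC⟩ := hF
  have hmem : Memℓp (boundaryCoeff F) 2 := by
    refine memℓp_gen' (C := (2 * Real.pi)⁻¹ * C) fun s => ?_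
    simpa using sum_boundaryCoeff_le hdiff hC s
  -- `G` is built from the Taylor coefficients; the dilates of F converge to it in L², hence almost
  -- everywhere along a subsequence, which identifies it with the given radial limit.
  let G : L2Circle := fourierBasis.repr.symm ⟨boundaryCoeff F, hmem⟩
  have hG : ∀ k, fourierCoeff G k = boundaryCoeff F k := fun k => by
    rw [← fourierBasis_repr, LinearIsometryEquiv.apply_symm_apply]
  let r : ℕ → ℝ := fun j => 1 - 1 / ((j : ℝ) + 1)
  have hr0 : ∀ j, 0 ≤ r j := fun j => by
    have : 1 / ((j : ℝ) + 1) ≤ 1 := by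
      rw [div_le_one (by positivity)]
      linarith [j.cast_nonneg (α := ℝ)]
    simp only [r]
    linarith
  have hr1 : ∀ j, r j < 1 := fun j => by
    have : 0 < 1 / ((j : ℝ) + 1) := by positivity
    simp only [r]
    linarith
  have hr : Tendsto r atTop (𝓝 1) := by
    have := (tendsto_one_div_add_atTop_nhds_zero_nat (𝕜 := ℝ)).const_sub 1
    rwa [sub_zero] at this
  choose P hP hPc using fun j => exists_circle_restriction hdiff (hr0 j) (hr1 j)
  have hPG : Tendsto P atTop (𝓝 G) := by
    rw [tendsto_iff_norm_sub_tendsto_zero]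
    have hsq : Tendsto (fun j => ‖P j - G‖ ^ 2) atTop (𝓝 0) := by
      have hterm : ∀ j k, fourierCoeff (P j - G : L2Circle) k =
          ((r j : ℂ) ^ k.toNat - 1) * fourierCoeff G k := by
        intro j k
        rw [← inner_fourierLp, inner_sub_right, inner_fourierLp, inner_fourierLp, hPc, hG]
        ring
      have h0 : (0 : ℝ) = ∑' _ : ℤ, (0 : ℝ) := tsum_zero.symm
      simp only [← (hasSum_norm_sq _).tsum_eq, hterm]
      rw [h0]
      refine tendsto_tsum_of_dominated_convergence (hasSum_norm_sq G).summable (fun k => ?_)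
        (Eventually.of_forall fun j k => ?_)
      · have hcont : Continuous fun t : ℝ =>
            ‖((t : ℂ) ^ k.toNat - 1) * fourierCoeff G k‖ ^ 2 := by fun_prop
        have := (hcont.tendsto 1).comp hr
        simpa [Function.comp_def] using this
      · rw [Real.norm_of_nonneg (sq_nonneg _), norm_mul, mul_pow]
        have h1 : ‖(r j : ℂ) ^ k.toNat - 1‖ ≤ 1 := by
          rw [← Complex.ofReal_pow, ← Complex.ofReal_one, ← Complex.ofReal_sub, Complex.norm_real,
            Real.norm_eq_abs, abs_le]
          have h2 : 0 ≤ r j ^ k.toNat := pow_nonneg (hr0 j) _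
          have h3 : r j ^ k.toNat ≤ 1 := pow_le_one₀ (hr0 j) (hr1 j).le
          constructor <;> linarith
        exact mul_le_of_le_one_left (sq_nonneg _) (pow_le_one₀ (norm_nonneg _) h1)
    have := (Real.continuous_sqrt.tendsto 0).comp hsq
    rw [Real.sqrt_zero] at this
    exact this.congr fun j => Real.sqrt_sq (norm_nonneg _)
  refine ⟨G, mem_hardySpace.2 fun n hn => ?_, ?_, ?_⟩
  · rw [hG, boundaryCoeff, if_neg (by omega)]
  · obtain ⟨ns, hns, hlim⟩ := (tendstoInMeasure_of_tendsto_Lp hPG).exists_seq_tendsto_ae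
    filter_upwards [hlim, ae_all_iff.2 hP, ae_volume_iff_ae_haarAddCircle.1 hg] with θ h1 h2 h3
    simp only [h2] at h1
    refine tendsto_nhds_unique h1 (h3.comp ?_)
    exact tendsto_nhdsWithin_iff.2
      ⟨hr.comp hns.tendsto_atTop, Eventually.of_forall fun j => hr1 _⟩
  · rw [hG, boundaryCoeff, if_pos le_rfl]
    have h := hasSum_single (f := fun n : ℕ => taylorCoeff F n * 0 ^ n) 0
      fun n hn => by rw [zero_pow hn, mul_zero]
    rw [pow_zero, mul_one] at h
    exact h.unique (hasSum_taylorCoeff hdiff (by simp))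

/-! ### Consequences of the Paley–Wiener condition -/

theorem ae_pos_of_paleyWiener {f : UnitCircle → ℝ} (hf : AEMeasurable f) (hpw : PaleyWiener f) :
    ∀ᵐ θ, 0 < f θ := by
  have hm : AEMeasurable fun θ => (-ENNReal.log (ENNReal.ofReal (f θ))).toENNReal :=
    (ENNReal.measurable_log.comp_aemeasurable hf.ennreal_ofReal).neg.ereal_toENNReal
  filter_upwards [ae_lt_top' hm hpw.ne] with θ h
  by_contra hle
  -- Where f ≤ 0 the extended logarithm is -∞, so the integrand would be infinite.
  rw [ENNReal.log_ofReal, if_pos (not_lt.1 hle)] at h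
  simp at h

/-- The condition controls the negative part of log f; the positive part is at most f because log t
≤ t - 1. -/
theorem integrable_log_of_paleyWiener {f : UnitCircle → ℝ} (hf : Integrable f)
    (hpw : PaleyWiener f) : Integrable fun θ => Real.log (f θ) := by
  have hpos := ae_pos_of_paleyWiener hf.aemeasurable hpw
  refine ⟨(Real.measurable_log.comp_aemeasurable hf.aemeasurable).aestronglyMeasurable, ?_⟩
  have hle : ∀ᵐ θ, ‖Real.log (f θ)‖ₑ ≤
      (-ENNReal.log (ENNReal.ofReal (f θ))).toENNReal + ‖f θ‖ₑ := by
    filter_upwards [hpos] with θ h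
    rw [ENNReal.log_ofReal_of_pos h, ← EReal.coe_neg, EReal.toENNReal_of_ne_top (by simp),
      EReal.toReal_coe, Real.enorm_eq_ofReal_abs, Real.enorm_eq_ofReal h.le]
    rcases le_total 0 (Real.log (f θ)) with h0 | h0
    · rw [abs_of_nonneg h0]
      refine le_add_left (ENNReal.ofReal_le_ofReal ?_)
      linarith [Real.log_le_sub_one_of_pos h]
    · rw [abs_of_nonpos h0]
      exact le_self_add
  refine (lintegral_mono_ae hle).trans_lt ?_
  rw [lintegral_add_right' _ hf.1.enorm]
  exact ENNReal.add_lt_top.2 ⟨hpw, hf.2⟩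

/-! ### Transfer to the model and conclusion -/

theorem inner_rotations (g : L2Circle) (n m : ℤ) :
    inner ℂ (rotations g n) (rotations g m) =
      ∫ θ, (fourier (n - m) θ : ℂ) * (‖g θ‖ ^ 2 : ℝ) ∂haarAddCircle := by
  rw [rotations, rotations, inner_mulL_fourier, L2.inner_def]
  refine integral_congr_ae ?_
  filter_upwards [coeFn_mulL (fourier (-m - -n)) g] with θ h
  rw [h, RCLike.inner_apply, mul_assoc, RCLike.mul_conj, show -m - -n = n - m by ring]
  norm_cast

end StationaryPrediction

theorem mainTheorem1 {H : Type*} [NormedAddCommGroup H] [InnerProductSpace ℂ H] [CompleteSpace H]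
    (x : ℤ → H) (hx : StationaryPrediction.IsStationary x)
    (μ : Measure StationaryPrediction.UnitCircle)
    (hμ : StationaryPrediction.IsSpectralMeasure x μ)
    (f : StationaryPrediction.UnitCircle → ℝ)
    (hf_int : Integrable f) (hf_nonneg : ∀ᵐ θ, 0 ≤ f θ)
    (hf_density : μ = volume.withDensity (fun θ => ENNReal.ofReal (f θ)))
    (hf_pw : StationaryPrediction.PaleyWiener f)
    (F : ℂ → ℂ) (fplus : StationaryPrediction.UnitCircle → ℂ)
    (hF : StationaryPrediction.IsOuterTwo F fplus)
    (hfactor : ∀ᵐ θ, f θ = ‖fplus θ‖ ^ 2)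
    (L : ℕ) (hL : 1 ≤ L) :
    StationaryPrediction.predictionError x L ^ 2
        = ∑ n ∈ Finset.range L, ‖fourierCoeff fplus (n : ℤ)‖ ^ 2 ∧
      IsGLB (StationaryPrediction.finitePredictionErrors x L)
        (Real.sqrt (∑ n ∈ Finset.range L, ‖fourierCoeff fplus (n : ℤ)‖ ^ 2)) := by
  open StationaryPrediction AddCircle in
  obtain ⟨hHardy, hbdry, houter⟩ := hF
  obtain ⟨G, hG, hGf, hG0⟩ := exists_mem_hardySpace hHardy hbdry
  have hpos := ae_volume_iff_ae_haarAddCircle.1 (ae_pos_of_paleyWiener hf_int.aemeasurable hf_pw)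
  have hfG : ∀ᵐ θ ∂haarAddCircle, f θ = ‖G θ‖ ^ 2 := by
    filter_upwards [ae_volume_iff_ae_haarAddCircle.1 hfactor, hGf] with θ h1 h2
    rw [h1, h2]
  have hGne : ∀ᵐ θ ∂haarAddCircle, G θ ≠ 0 := by
    filter_upwards [hpos, hfG] with θ h1 h2 h3
    rw [h2, h3] at h1
    simp at h1
  have hlog : Integrable (fun θ => Real.log ‖G θ‖) haarAddCircle := by
    have h := integrable_log_of_paleyWiener hf_int hf_pw
    rw [volume_eq_smul_haarAddCircle, integrable_smul_measure
      (ENNReal.ofReal_pos.2 Real.two_pi_pos).ne' ENNReal.ofReal_ne_top] at h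
    refine (h.const_mul 2⁻¹).congr ?_
    filter_upwards [hfG] with θ h1
    rw [h1, Real.log_pow]
    push_cast
    ring
  have hGouter : ‖fourierCoeff G 0‖ = Real.exp (∫ θ, Real.log ‖G θ‖ ∂haarAddCircle) := by
    have hint : ∫ θ, Real.log ‖G θ‖ ∂haarAddCircle = ∫ θ, Real.log ‖fplus θ‖ ∂haarAddCircle :=
      integral_congr_ae (hGf.fun_comp fun z => Real.log ‖z‖)
    rw [hG0, houter, hint, integral_haarAddCircle, smul_eq_mul, one_div]
  -- The exponent -m in the spectral representation is why the model rotates by e^{-ikθ}: both sides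
  -- are the mean of e^{i(n-m)θ}f.
  have hgram : ∀ n m, inner ℂ (x n) (x m) = inner ℂ (rotations G n) (rotations G m) := by
    intro n m
    have h := hμ.2 n (m - n)
    rw [add_sub_cancel, hf_density, integral_withDensity_eq_integral_toReal_smul₀
      hf_int.aemeasurable.ennreal_ofReal (Eventually.of_forall fun _ => ENNReal.ofReal_lt_top)] at h
    rw [h, inner_rotations, integral_haarAddCircle, Complex.real_smul]
    congr 1
    · push_cast
      rw [one_div]
    · refine integral_congr_ae ?_
      filter_upwards [hf_nonneg, ae_volume_iff_ae_haarAddCircle.2 hfG] with θ h1 h2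
      rw [ENNReal.toReal_ofReal h1, h2, Complex.real_smul, mul_comm, neg_sub]
  have hglb := isGLB_finitePredictionErrors x L
  have herr : predictionError x L = predictionError (rotations G) L := by
    refine hglb.unique ?_
    rw [finitePredictionErrors_eq_of_gram hgram]
    exact isGLB_finitePredictionErrors (rotations G) L
  have hsq : predictionError x L ^ 2 =
      ∑ n ∈ Finset.range L, ‖fourierCoeff fplus (n : ℤ)‖ ^ 2 := by
    rw [herr, predictionError_rotations_sq hG (one_mem_past_rotations hG hGne hlog hGouter)]
    simp only [fourierCoeff_congr_ae hGf]
  refine ⟨hsq, ?_⟩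
  have herr_nonneg : 0 ≤ predictionError x L := norm_nonneg _
  rwa [← hsq, Real.sqrt_sq herr_nonneg]
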